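/- Let $\mathcal C$ be a finite rigid tensor category over $\mathbb C$, i.e. a $\mathbb C$-linear abelian category which is $\mathbb C$-linearly equivalent to the category of finite dimensional representations of some finite dimensional $\mathbb C$-algebra, equipped with a monoidal structure whose tensor product is $\mathbb C$-bilinear on morphisms and for which every object $X$ has a right dual $X^*$ (with evaluation $\mathrm{ev}_X : X^*\otimes X\to \mathbf 1$ and coevaluation $\mathrm{coev}_X:\mathbf 1\to X\otimes X^*$) and a left dual ${}^*X$ (so that $({}^*X)^*=X$). ($\mathcal C$ need not be semisimple; the tensor product is automatically biexact.) Let $\beta$ be a braiding on $\mathcal C$, and write $\beta^2_{XY}=\beta_{YX}\beta_{XY}: X\otimes Y\to X\otimes Y$. Let $u_X: X\to X^{**}$ be the Drinfeld morphism $$u_X=(\mathrm{ev}_X\,\beta_{X,X^*}\otimes 1_{X^{**}})(1_X\otimes \mathrm{coev}_{X^*}),$$ and let $z_X=(u_{{}^*X})^*\,u_X : X\to X^{**}\to X$ be the Casimir automorphism. Call an endomorphism $f$ of an object quasi-unipotent if $f^N$ is unipotent (that is, $f^N-1$ is nilpotent) for some positive integer $N$. Then: 1. for all objects $X,Y$ of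 $\mathcal C$, the automorphism $\beta^2_{XY}$ is quasi-unipotent; 2. for every object $X$ of $\mathcal C$, the Casimir automorphism $z_X$ is quasi-unipotent. -/

import Mathlib

open CategoryTheory MonoidalCategory HasRightDual HasLeftDual

universe v u

noncomputable section

/-- The property of being finite dimensional over `ℂ`, for modules over a `ℂ`-algebra `A`. -/
def IsFinDimRep (A : Type) [Ring A] [Algebra ℂ A] : ObjectProperty (ModuleCat.{0} A) :=
  fun M => @Module.Finite ℂ M _ _ (ModuleCat.moduleOfAlgebraModule M)

/-- The category of finite dimensional representations of a `ℂ`-algebra `A`,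
as a full subcategory of the category of `A`-modules. -/
abbrev FinDimRep (A : Type) [Ring A] [Algebra ℂ A] : Type 1 :=
  (IsFinDimRep A).FullSubcategory

/-- A `ℂ`-linear category is finite if it is `ℂ`-linearly equivalent to the category of finite
dimensional representations of some finite dimensional `ℂ`-algebra.  (Every finite dimensional
algebra and every finite dimensional module has a copy in `Type`, so fixing the universe of `A`
and of its modules is no restriction.) -/
def IsFiniteLinearCategory (C : Type u) [Category.{v} C] [Preadditive C] [Linear ℂ C] : Prop :=
  ∃ (A : Type) (_ : Ring A) (_ : Algebra ℂ A) (_ : Module.Finite ℂ A) (e : C ≌ FinDimRep A),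
    e.functor.Additive ∧ e.functor.Linear ℂ

/-- An endomorphism `f` of an object of a preadditive category is quasi-unipotent if some positive
power `f ^ N` (in the endomorphism ring) is unipotent, that is, `f ^ N - 1` is nilpotent. -/
def IsQuasiUnipotent {C : Type u} [Category.{v} C] [Preadditive C] {X : C} (f : End X) : Prop :=
  ∃ N : ℕ, 0 < N ∧ IsNilpotent (f ^ N - 1)

section Braided

variable {C : Type u} [Category.{v} C] [MonoidalCategory C] [BraidedCategory C]

/-- The squared braiding `β_{YX} ∘ β_{XY} : X ⊗ Y ⟶ X ⊗ Y`. -/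
def braidingSq (X Y : C) : End (X ⊗ Y) :=
  (β_ X Y).hom ≫ (β_ Y X).hom

/-- The Drinfeld morphism `u_X : X ⟶ X**`,
`u_X = (ev_X ∘ β_{X, X*} ⊗ 1_{X**}) ∘ (1_X ⊗ coev_{X*})`,
where `X* = rightDual X` comes with `coev_X : 𝟙 ⟶ X ⊗ X*` and `ev_X : X* ⊗ X ⟶ 𝟙`. -/
def drinfeldMorphism (X : C) [HasRightDual X] [HasRightDual (rightDual X)] :
    X ⟶ rightDual (rightDual X) :=
  (ρ_ X).inv ≫ X ◁ η_ (rightDual X) (rightDual (rightDual X)) ≫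
    (α_ X (rightDual X) (rightDual (rightDual X))).inv ≫
    ((β_ X (rightDual X)).hom ≫ ε_ X (rightDual X)) ▷ rightDual (rightDual X) ≫
    (λ_ (rightDual (rightDual X))).hom

/-- The Casimir automorphism `z_X = (u_{*X})* ∘ u_X : X ⟶ X** ⟶ X`.  Here `*X = leftDual X` is the left
dual of `X`, and `X` is used as the right dual `(*X)*` of `*X`, so that `u_{*X} : *X ⟶ X*` and its
dual is a morphism `X** ⟶ X`. -/
def casimir [RigidCategory C] (X : C) : End X :=
  let w : leftDual X ⟶ rightDual X := drinfeldMorphism (leftDual X)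
  let w' : rightDual (rightDual X) ⟶ X := rightAdjointMate w
  drinfeldMorphism X ≫ w'

end Braided

end

/-!
The proof works with the squared braiding `D_{X,Y} : X ⊗ Y ⟶ X ⊗ Y` and the Casimir morphism `z_X`,
and follows Vafa's argument, with eigenvalues of `z` in the place of twists of simple objects.

Unwinding the Drinfeld morphisms shows that `z_X` is characterised by `e ∘ D_{X,Y} = e ∘ (z_X ⊗ 1)`
for every pairing `e : X ⊗ Y ⟶ 𝟙_ C` (`isCasimir_casimir`).  This makes `z` natural in `X`, and
gives `z_{*X}` the scalar value of `z_X` whenever the latter is a scalar.  Computing the full twist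
on three strands in two ways yields `D_{X,Z} z_{X ⊗ Z} D_{X,Z} = z_X ⊗ z_Z`
(`IsCasimir.tensor`), so that it suffices to show that all eigenvalues of `z` are roots of unity.

Let `Λ` be the set of these eigenvalues.  Each `l ∈ Λ` occurs as `z_X = l` on some nonzero object
`X`, a kernel or a cokernel; `Λ` is finite because the category has a generator, and `0 ∉ Λ`
because `D` is invertible.  With `Y = *X` and `T = X ⊗ (Y ⊗ X)`, the hexagon identity factors
`D_{X, Y ⊗ X}` as a conjugate of `Y ⊗ D_{X,X}` times `D_{X,Y} ⊗ X`.  These endomorphisms commute with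
`z_T`, hence act on the `l`-eigenspace `V` of `z_T` on `P ⟶ T`, where `P` is a generator; and `V ≠ 0`
because `X` is a retract of `T`.  The squares of the determinants on `V` are known in terms of `z`,
which leads to
`l ^ (4 * dim V) = det z_{Y ⊗ X} * det z_{X ⊗ Y} * det z_{X ⊗ X}`, a product of `3 * dim V` elements
of `Λ` (`exists_multiset_of_mem_casimirSpectrum`).  Read additively, these relations
form a linear system over `ℤ` in the elements of `Λ` whose matrix is strictly diagonally
dominant.  Its determinant is therefore a nonzero integer that kills every element of `Λ`
(`Finset.isOfFinOrder_of_pow_eq_multiset_prod`).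
-/

/-! ### Perfect pairings -/

section Pairing

variable {C : Type u} [Category.{v} C] [MonoidalCategory C]

/-- A morphism into `X` is determined by its composite with a perfect pairing `X ⊗ Y ⟶ 𝟙_ C`. -/
lemma eq_of_whiskerRight_comp_evaluation {X Y A : C} [ExactPairing Y X] {f g : A ⟶ X}
    (h : f ▷ Y ≫ ε_ Y X = g ▷ Y ≫ ε_ Y X) : f = g := by
  have key : f ≫ (λ_ X).inv = g ≫ (λ_ X).inv := by
    apply (tensorRightHomEquiv A Y X (𝟙_ C)).symm.injective
    simp [tensorRightHomEquiv, reassoc_of% h]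
  simpa using key

/-- A morphism into `B ⊗ X` is determined by its contraction with a perfect pairing
`X ⊗ Y ⟶ 𝟙_ C`. -/
lemma eq_of_whiskerRight_comp_whiskerLeft_evaluation {X Y A B : C} [ExactPairing Y X]
    {f g : A ⟶ B ⊗ X}
    (h : f ▷ Y ≫ (α_ B X Y).hom ≫ B ◁ ε_ Y X ≫ (ρ_ B).hom =
      g ▷ Y ≫ (α_ B X Y).hom ≫ B ◁ ε_ Y X ≫ (ρ_ B).hom) : f = g :=
  (tensorRightHomEquiv A Y X B).symm.injective h

end Pairing

/-! ### The squared braiding -/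

section Braided

variable {C : Type u} [Category.{v} C] [MonoidalCategory C] [BraidedCategory C]

/-- The squared braiding as a plain morphism, so that it composes with morphisms that are not
endomorphisms. -/
def doubleBraiding (X Y : C) : X ⊗ Y ⟶ X ⊗ Y :=
  (β_ X Y).hom ≫ (β_ Y X).hom

lemma doubleBraiding_naturality_left {X X' : C} (f : X ⟶ X') (Y : C) :
    f ▷ Y ≫ doubleBraiding X' Y = doubleBraiding X Y ≫ f ▷ Y := by
  simp [doubleBraiding]

lemma doubleBraiding_naturality_right (X : C) {Y Y' : C} (f : Y ⟶ Y') :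
    X ◁ f ≫ doubleBraiding X Y' = doubleBraiding X Y ≫ X ◁ f := by
  simp [doubleBraiding]

lemma doubleBraiding_comp_whiskerLeft_unit (X : C) {Y : C} (e : Y ⟶ 𝟙_ C) :
    doubleBraiding X Y ≫ X ◁ e = X ◁ e := by
  rw [← doubleBraiding_naturality_right]
  simp [doubleBraiding]

/-- The two half twists on three strands agree. -/
lemma braiding_half_twist (X Y Z : C) :
    (β_ X Y).hom ▷ Z ≫ (β_ (Y ⊗ X) Z).hom =
      (α_ X Y Z).hom ≫ X ◁ (β_ Y Z).hom ≫ (β_ X (Z ⊗ Y)).hom ≫ (α_ Z Y X).hom := by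
  rw [BraidedCategory.braiding_naturality_left]
  simp [BraidedCategory.braiding_tensor_left_hom, BraidedCategory.braiding_tensor_right_hom]

/-- The two ways of writing the full twist on three strands agree. -/
lemma braiding_full_twist (X Y Z : C) :
    doubleBraiding X Y ▷ Z ≫ doubleBraiding (X ⊗ Y) Z =
      (α_ X Y Z).hom ≫ X ◁ doubleBraiding Y Z ≫ doubleBraiding X (Y ⊗ Z) ≫ (α_ X Y Z).inv := by
  calc
    _ = ((β_ X Y).hom ▷ Z ≫ (β_ (Y ⊗ X) Z).hom) ≫ Z ◁ (β_ Y X).hom ≫ (β_ Z (X ⊗ Y)).hom := by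
      simp only [doubleBraiding, comp_whiskerRight, Category.assoc]
      rw [BraidedCategory.braiding_naturality_left_assoc]
    _ = (α_ X Y Z).hom ≫ X ◁ (β_ Y Z).hom ≫ (β_ X (Z ⊗ Y)).hom ≫
          ((β_ Z Y).hom ▷ X ≫ (β_ (Y ⊗ Z) X).hom) ≫ (α_ X Y Z).inv := by
      rw [braiding_half_twist, braiding_half_twist]
      simp only [Category.assoc, Iso.hom_inv_id, Category.comp_id]
    _ = _ := by
      simp only [doubleBraiding, whiskerLeft_comp, Category.assoc]
      rw [BraidedCategory.braiding_naturality_right_assoc X (β_ Z Y).hom]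

/-- The hexagon identities for the squared braiding. -/
lemma doubleBraiding_tensor_right (X Y Z : C) :
    doubleBraiding X (Y ⊗ Z) =
      (α_ X Y Z).inv ≫ (β_ X Y).hom ▷ Z ≫ (α_ Y X Z).hom ≫ Y ◁ doubleBraiding X Z ≫
        (α_ Y X Z).inv ≫ (β_ Y X).hom ▷ Z ≫ (α_ X Y Z).hom := by
  simp [doubleBraiding, BraidedCategory.braiding_tensor_left_hom,
    BraidedCategory.braiding_tensor_right_hom]

/-- The pairing of `X ⊗ Z` with `W ⊗ Y` that contracts the inner factors `Z`, `W` first and then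
the outer factors `X`, `Y`. -/
def nestedPairing {X Z W Y : C} (e : Z ⊗ W ⟶ 𝟙_ C) (e' : X ⊗ Y ⟶ 𝟙_ C) :
    (X ⊗ Z) ⊗ (W ⊗ Y) ⟶ 𝟙_ C :=
  (α_ (X ⊗ Z) W Y).inv ≫ ((α_ X Z W).hom ≫ X ◁ e ≫ (ρ_ X).hom) ▷ Y ≫ e'

/-- Sliding a strand `Y` through the pairing of `Z` and `W`. -/
lemma braiding_comp_whiskerRight_pairing {Z W : C} (e : Z ⊗ W ⟶ 𝟙_ C) (Y : C) :
    Z ◁ (β_ Y W).hom ≫ (α_ Z W Y).inv ≫ e ▷ Y ≫ (λ_ Y).hom =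
      (α_ Z Y W).inv ≫ (β_ Y Z).inv ▷ W ≫ (α_ Y Z W).hom ≫ Y ◁ e ≫ (ρ_ Y).hom := by
  have h := BraidedCategory.braiding_naturality_right Y e
  rw [braiding_tensorUnit_right, ← Category.assoc, Iso.comp_inv_eq,
    BraidedCategory.braiding_tensor_right_hom] at h
  simp only [Category.assoc] at h
  rw [h]
  simp

/-- Sliding a strand `Z` through the pairing of `X` and `Y`. -/
lemma braiding_inv_comp_pairing_whiskerRight {X Y : C} (e : X ⊗ Y ⟶ 𝟙_ C) (Z : C) :
    (α_ X Z Y).hom ≫ X ◁ (β_ Y Z).inv ≫ (α_ X Y Z).inv ≫ e ▷ Z ≫ (λ_ Z).hom =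
      (β_ X Z).hom ▷ Y ≫ (α_ Z X Y).hom ≫ Z ◁ e ≫ (ρ_ Z).hom := by
  have h := BraidedCategory.braiding_naturality_left e Z
  rw [braiding_tensorUnit_left, ← Category.assoc, Iso.comp_inv_eq,
    BraidedCategory.braiding_tensor_left_hom] at h
  simp only [Category.assoc] at h
  rw [h]
  simp

/-- Crossing the two strands on the right of a nested pairing amounts to crossing the two on the
left, which interchanges inner and outer. -/
lemma nestedPairing_braiding {X Z W Y : C} (e : Z ⊗ W ⟶ 𝟙_ C) (e' : X ⊗ Y ⟶ 𝟙_ C) :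
    (X ⊗ Z) ◁ (β_ Y W).hom ≫ nestedPairing e e' =
      (β_ X Z).hom ▷ (Y ⊗ W) ≫ nestedPairing e' e := by
  calc
    _ = (α_ X Z (Y ⊗ W)).hom ≫
          X ◁ (Z ◁ (β_ Y W).hom ≫ (α_ Z W Y).inv ≫ e ▷ Y ≫ (λ_ Y).hom) ≫ e' := by
      simp [nestedPairing]
    _ = (α_ X Z (Y ⊗ W)).hom ≫
          X ◁ ((α_ Z Y W).inv ≫ (β_ Y Z).inv ▷ W ≫ (α_ Y Z W).hom) ≫ (α_ X Y (Z ⊗ W)).inv ≫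
            ((X ⊗ Y) ◁ e ≫ e' ▷ (𝟙_ C)) ≫ (λ_ (𝟙_ C)).hom := by
      rw [braiding_comp_whiskerRight_pairing]
      simp [unitors_equal]
    _ = (α_ (X ⊗ Z) Y W).inv ≫ ((α_ X Z Y).hom ≫ X ◁ (β_ Y Z).inv ≫ (α_ X Y Z).inv ≫
          e' ▷ Z ≫ (λ_ Z).hom) ▷ W ≫ e := by
      rw [whisker_exchange]
      simp
    _ = _ := by
      rw [braiding_inv_comp_pairing_whiskerRight]
      simp [nestedPairing]

/-- The squared braiding of `W` and `Y` is the mate of that of `X` and `Z`. -/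
lemma nestedPairing_doubleBraiding {X Z W Y : C} (e : Z ⊗ W ⟶ 𝟙_ C) (e' : X ⊗ Y ⟶ 𝟙_ C) :
    (X ⊗ Z) ◁ doubleBraiding W Y ≫ nestedPairing e e' =
      doubleBraiding X Z ▷ (W ⊗ Y) ≫ nestedPairing e e' := by
  rw [doubleBraiding, whiskerLeft_comp, Category.assoc, nestedPairing_braiding,
    whisker_exchange_assoc, nestedPairing_braiding, doubleBraiding, comp_whiskerRight,
    Category.assoc]

/-! ### The Casimir morphism through pairings -/

/-- `z` acts on `X` as the Casimir morphism does: under every pairing of `X` with an object `Y`,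
the squared braiding of `X` and `Y` becomes `z`. -/
def IsCasimir (X : C) (z : X ⟶ X) : Prop :=
  ∀ (Y : C) (e : X ⊗ Y ⟶ 𝟙_ C), doubleBraiding X Y ≫ e = z ▷ Y ≫ e

/-- A perfect pairing suffices as a test, since every other pairing factors through it. -/
lemma IsCasimir.of_evaluation {X Y : C} [ExactPairing Y X] {z : X ⟶ X}
    (h : doubleBraiding X Y ≫ ε_ Y X = z ▷ Y ≫ ε_ Y X) : IsCasimir X z := by
  intro W e
  obtain ⟨f, rfl⟩ : ∃ f : W ⟶ Y, X ◁ f ≫ ε_ Y X = e := by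
    refine ⟨tensorLeftHomEquiv W Y X (𝟙_ C) e ≫ (ρ_ Y).hom, ?_⟩
    conv_rhs => rw [← (tensorLeftHomEquiv W Y X (𝟙_ C)).symm_apply_apply e]
    generalize tensorLeftHomEquiv W Y X (𝟙_ C) e = g
    simp [tensorLeftHomEquiv, unitors_equal]
  rw [← reassoc_of% @doubleBraiding_naturality_right, h, whisker_exchange_assoc]

/-- The Drinfeld morphism turns the evaluation of `X**` into the braided evaluation of `X`. -/
lemma drinfeldMorphism_whiskerRight_evaluation (X : C) [HasRightDual X]
    [HasRightDual (rightDual X)] :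
    drinfeldMorphism X ▷ rightDual X ≫ ε_ (rightDual X) (rightDual (rightDual X)) =
      (β_ X (rightDual X)).hom ≫ ε_ X (rightDual X) := by
  have h : drinfeldMorphism X ≫ (λ_ _).inv = tensorRightHomEquiv X (rightDual X)
      (rightDual (rightDual X)) (𝟙_ C) ((β_ X (rightDual X)).hom ≫ ε_ X (rightDual X)) := by
    simp [drinfeldMorphism, tensorRightHomEquiv]
  rw [← Equiv.symm_apply_eq] at h
  rw [← h]
  simp [tensorRightHomEquiv, ← unitors_equal]

section
variable [RigidCategory C]

/-- The two Drinfeld morphisms in `casimir X` contribute the two factors of the squared braiding. -/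
lemma isCasimir_casimir (X : C) : IsCasimir X (casimir X) := by
  refine IsCasimir.of_evaluation (Y := leftDual X) ?_
  have h := rightAdjointMate_comp_evaluation (drinfeldMorphism (leftDual X))
  have h' := drinfeldMorphism_whiskerRight_evaluation (leftDual X)
  rw [casimir, comp_whiskerRight, Category.assoc]
  -- The dual of `leftDual X` is `X` only up to unfolding of instances.
  erw [h, ← whisker_exchange_assoc, drinfeldMorphism_whiskerRight_evaluation X,
    BraidedCategory.braiding_naturality_right_assoc, h']
  simp [doubleBraiding]

lemma IsCasimir.naturality {X X' : C} {z : X ⟶ X} {z' : X' ⟶ X'} (h : IsCasimir X z)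
    (h' : IsCasimir X' z') (f : X ⟶ X') : z ≫ f = f ≫ z' := by
  apply eq_of_whiskerRight_comp_evaluation (Y := leftDual X')
  rw [comp_whiskerRight, comp_whiskerRight, Category.assoc, Category.assoc, ← h' , ← h,
   reassoc_of% @doubleBraiding_naturality_left]

lemma commute_casimir {X : C} (f : End X) : Commute (casimir X) f :=
  ((isCasimir_casimir X).naturality (isCasimir_casimir X) f).symm

lemma IsCasimir.eq_casimir {X : C} {z : X ⟶ X} (h : IsCasimir X z) : casimir X = z := by
  simpa using (isCasimir_casimir X).naturality h (𝟙 X)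

/-- The Casimir morphism is multiplicative up to the squared braiding. -/
lemma IsCasimir.tensor {X Z : C} {x : X ⟶ X} {z : Z ⟶ Z} {t : X ⊗ Z ⟶ X ⊗ Z}
    (hx : IsCasimir X x) (hz : IsCasimir Z z) (ht : IsCasimir (X ⊗ Z) t) :
    doubleBraiding X Z ≫ t ≫ doubleBraiding X Z = X ◁ z ≫ x ▷ Z := by
  set W := leftDual Z
  set Y := leftDual X
  set k : (X ⊗ Z) ⊗ W ⟶ X := (α_ X Z W).hom ≫ X ◁ ε_ W Z ≫ (ρ_ X).hom with hk
  -- the full twist on the strands `X`, `Z`, `W`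
  have h1 : doubleBraiding X Z ▷ W ≫ doubleBraiding (X ⊗ Z) W ≫ k = (X ◁ z) ▷ W ≫ k := by
    rw [← Category.assoc, braiding_full_twist, hk]
    simp only [Category.assoc, Iso.inv_hom_id_assoc]
    rw [reassoc_of% @doubleBraiding_comp_whiskerLeft_unit, ← whiskerLeft_comp_assoc, hz]
    simp
  have hE : nestedPairing (ε_ W Z) (ε_ Y X) = (α_ (X ⊗ Z) W Y).inv ≫ k ▷ Y ≫ ε_ Y X := rfl
  -- the full twist on the strands `X ⊗ Z`, `W`, `Y`
  have h2 : (doubleBraiding (X ⊗ Z) W ≫ k ≫ x) = (t ≫ doubleBraiding X Z) ▷ W ≫ k := by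
    apply eq_of_whiskerRight_comp_evaluation (Y := Y)
    have hT := ht _ (nestedPairing (ε_ W Z) (ε_ Y X))
    have hF := braiding_full_twist (X ⊗ Z) W Y
    calc
      _ = (doubleBraiding (X ⊗ Z) W ▷ Y ≫ doubleBraiding ((X ⊗ Z) ⊗ W) Y) ≫ k ▷ Y ≫ ε_ Y X := by
        simp only [comp_whiskerRight, Category.assoc]
        rw [← hx, reassoc_of% @doubleBraiding_naturality_left]
      _ = (α_ (X ⊗ Z) W Y).hom ≫ (X ⊗ Z) ◁ doubleBraiding W Y ≫
            t ▷ (W ⊗ Y) ≫ nestedPairing (ε_ W Z) (ε_ Y X) := by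
        rw [hF, ← hT, hE]
        simp only [Category.assoc]
      _ = (α_ (X ⊗ Z) W Y).hom ≫ (t ≫ doubleBraiding X Z) ▷ (W ⊗ Y) ≫
            nestedPairing (ε_ W Z) (ε_ Y X) := by
        rw [whisker_exchange_assoc, nestedPairing_doubleBraiding, comp_whiskerRight,
          Category.assoc]
      _ = _ := by
        rw [hE]
        simp
  apply eq_of_whiskerRight_comp_whiskerLeft_evaluation (Y := W)
  rw [← hk, comp_whiskerRight, Category.assoc, ← h2, reassoc_of% h1, hk]
  simp only [comp_whiskerRight, Category.assoc]
  congr 1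
  rw [← rightUnitor_naturality, whisker_exchange_assoc]
  simp

/-- If `z_X` is a scalar, then the Casimir morphism of the dual of `X` is the same scalar. -/
lemma IsCasimir.smul_leftDual [Preadditive C] [Linear ℂ C] [MonoidalPreadditive C]
    [MonoidalLinear ℂ C] {X : C} {l : ℂ} (hx : IsCasimir X (l • 𝟙 X)) :
    IsCasimir (leftDual X) (l • 𝟙 (leftDual X)) := by
  let _ : ExactPairing X (leftDual X) := BraidedCategory.exactPairing_swap _ _
  refine IsCasimir.of_evaluation (Y := X) ?_
  have h : ε_ X (leftDual X) = (β_ (leftDual X) X).hom ≫ ε_ (leftDual X) X := rfl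
  have h' := hx _ (ε_ (leftDual X) X)
  rw [h]
  simp only [doubleBraiding, Category.assoc] at h' ⊢
  rw [h']
  simp

end
end Braided

/-! ### Linear algebra -/

section LinearAlgebra

/-- The determinant of a homogeneous system of linear equations kills its solutions, in any abelian
group. -/
lemma Matrix.det_smul_eq_zero {ι G : Type*} [Fintype ι] [DecidableEq ι] [AddCommGroup G]
    (M : Matrix ι ι ℤ) (x : ι → G) (h : ∀ a, ∑ b, M a b • x b = 0) (c : ι) : M.det • x c = 0 := by
  calc
    M.det • x c = ∑ b, (M.adjugate * M) c b • x b := by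
      simp [Matrix.adjugate_mul, Matrix.one_apply, ite_smul]
    _ = ∑ a, M.adjugate c a • ∑ b, M a b • x b := by
      simp_rw [Matrix.mul_apply, Finset.sum_smul, Finset.smul_sum, mul_smul]
      exact Finset.sum_comm
    _ = 0 := by simp [h]

/-- If, in a finite set `S`, every `a` has a power `a ^ (4 * N)` that is a product of only `3 * N`
elements of `S`, then `S` consists of elements of finite order. -/
lemma Finset.isOfFinOrder_of_pow_eq_multiset_prod {G : Type*} [CommGroup G] (S : Finset G)
    (h : ∀ a ∈ S, ∃ N > 0, ∃ m : Multiset G, m.card = 3 * N ∧ (∀ b ∈ m, b ∈ S) ∧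
      a ^ (4 * N) = m.prod) : ∀ a ∈ S, IsOfFinOrder a := by
  classical
  choose! N hN m hcard hmem hprod using h
  -- `M` is strictly diagonally dominant: its diagonal entries exceed the sum of the absolute values
  -- of the others in their row by `N a`, since the multiplicities in `m a` add up to `3 * N a`.
  let M : Matrix S S ℤ := fun a b => (if a = b then 4 * (N a : ℤ) else 0) - (m a).count (b : G)
  have hcount : ∀ a : S, ∑ b : S, (m a).count (b : G) = 3 * N a := fun a => by
    rw [← hcard a a.2, Finset.sum_coe_sort S (fun b => (m a).count b)]
    exact Multiset.sum_count_eq_card (hmem a a.2)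
  have hdet : M.det ≠ 0 := by
    have := det_ne_zero_of_sum_row_lt_diag (A := M.map (Int.castRingHom ℝ)) fun a => by
      have e1 : ∑ b ∈ Finset.univ.erase a, ‖M.map (Int.castRingHom ℝ) a b‖ =
          ∑ b ∈ Finset.univ.erase a, ((m a).count (b : G) : ℝ) := by
        refine Finset.sum_congr rfl fun b hb => ?_
        rw [Matrix.map_apply]
        simp [M, (Finset.ne_of_mem_erase hb).symm]
      have e2 : (∑ b ∈ Finset.univ.erase a, ((m a).count (b : G) : ℝ)) + (m a).count (a : G) =
          3 * N a := by
        rw [Finset.sum_erase_add _ _ (Finset.mem_univ a)]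
        exact_mod_cast hcount a
      have e3 : (0 : ℝ) < N a := by exact_mod_cast hN a a.2
      rw [e1]
      refine lt_of_lt_of_le ?_ (le_abs_self _)
      rw [Matrix.map_apply]
      simp only [M, if_true, Int.coe_castRingHom]
      push_cast
      linarith
    intro h0
    apply this
    rw [← RingHom.mapMatrix_apply, ← RingHom.map_det, h0, map_zero]
  intro a ha
  have key := M.det_smul_eq_zero (fun b : S => Additive.ofMul (b : G)) (fun a => by
    have h1 : ∑ b : S, ((m a).count (b : G) : ℤ) • Additive.ofMul (b : G) =
        Additive.ofMul (m a).prod := by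
      rw [Finset.prod_multiset_count_of_subset (m a) S
        (fun b hb => hmem a a.2 b (Multiset.mem_toFinset.1 hb)), ofMul_prod,
        ← Finset.sum_coe_sort S]
      simp
    simp only [M, sub_smul, Finset.sum_sub_distrib, h1, ite_smul, zero_smul, Finset.sum_ite_eq,
      Finset.mem_univ, if_true, ← hprod a a.2]
    simp [← ofMul_zpow, sub_eq_zero]
    norm_cast) ⟨a, ha⟩
  exact isOfFinOrder_iff_zpow_eq_one.2 ⟨M.det, hdet, by simpa [← ofMul_zpow] using key⟩

/-- A determinant computation on the `l`-eigenspace of `Q`, in the pattern of the hexagon identity: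
`Eᵢ` are squared braidings and `Q`, `Pᵢ` are Casimir morphisms.  The three determinants of the `Pᵢ`
multiply to `l ^ (4 * N)`, where `N` is the dimension of the eigenspace. -/
lemma Module.End.exists_multiset_of_hexagon {K H : Type*} [Field K] [IsAlgClosed K]
    [AddCommGroup H] [Module K H] [FiniteDimensional K H] {l : K} (hl : l ≠ 0)
    {Q E₁ E₂ E₃ P₁ P₂ P₃ : Module.End K H}
    (hE₁ : Commute Q E₁) (hE₂ : Commute Q E₂) (hE₃ : Commute Q E₃)
    (hP₁ : Commute Q P₁) (hP₂ : Commute Q P₂) (hP₃ : Commute Q P₃) (hE : E₁ = E₂ * E₃)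
    (h₁ : E₁ * Q * E₁ = l • P₁) (h₂ : E₂ * P₂ * E₂ = (l * l) • 1)
    (h₃ : E₃ * P₃ * E₃ = (l * l) • 1) :
    ∃ m : Multiset K, m.card = 3 * Module.finrank K (Q.eigenspace l) ∧
      (∀ b ∈ m, b ∈ spectrum K P₁ ∪ spectrum K P₂ ∪ spectrum K P₃) ∧
      l ^ (4 * Module.finrank K (Q.eigenspace l)) = m.prod := by
  set V := Q.eigenspace l
  set N := Module.finrank K V with hN
  have hV : ∀ {f : Module.End K H}, Commute Q f → ∀ v ∈ V, f v ∈ V := fun {f} hf v hv => by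
    rw [Module.End.mem_eigenspace_iff] at hv ⊢
    rw [← Module.End.mul_apply, hf.eq, Module.End.mul_apply, hv, map_smul]
  have hdet : ∀ {f : Module.End K H} (hf : Commute Q f), ∃ m : Multiset K, m.card = N ∧
      (∀ b ∈ m, b ∈ spectrum K f) ∧ LinearMap.det (f.restrict (hV hf)) = m.prod := by
    intro f hf
    refine ⟨(f.restrict (hV hf)).charpoly.roots, ?_, fun b hb => ?_,
      Module.End.det_eq_prod_roots_charpoly_of_splits (IsAlgClosed.splits _)⟩
    · rw [← (IsAlgClosed.splits _).natDegree_eq_card_roots, LinearMap.charpoly_natDegree]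
    · have hb' := (Module.End.hasEigenvalue_iff_isRoot_charpoly _ _).2
        (Polynomial.isRoot_of_mem_roots hb)
      obtain ⟨w, hw⟩ := hb'.exists_hasEigenvector
      apply Module.End.HasEigenvalue.mem_spectrum
      refine Module.End.hasEigenvalue_of_hasEigenvector (x := (w : H)) ⟨?_, ?_⟩
      · rw [Module.End.mem_eigenspace_iff]
        exact congrArg Subtype.val hw.apply_eq_smul
      · simpa using hw.2
  -- each determinant is the product of the `N` eigenvalues of the restricted operator
  obtain ⟨m₁, c₁, s₁, d₁⟩ := hdet hP₁
  obtain ⟨m₂, c₂, s₂, d₂⟩ := hdet hP₂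
  obtain ⟨m₃, c₃, s₃, d₃⟩ := hdet hP₃
  set e₁ := E₁.restrict (hV hE₁)
  set e₂ := E₂.restrict (hV hE₂)
  set e₃ := E₃.restrict (hV hE₃)
  set p₁ := P₁.restrict (hV hP₁)
  set p₂ := P₂.restrict (hV hP₂)
  set p₃ := P₃.restrict (hV hP₃)
  have r : e₁ = e₂ * e₃ := by
    ext v
    exact LinearMap.congr_fun hE v
  have r₁ : e₁ * e₁ = p₁ := by
    ext v
    have h := LinearMap.congr_fun h₁ v
    have hv := Module.End.mem_eigenspace_iff.1 (hV hE₁ _ v.2)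
    simp only [Module.End.mul_apply, hv, map_smul, LinearMap.smul_apply] at h
    exact (smul_right_injective H hl) h
  have r₂ : e₂ * p₂ * e₂ = (l * l) • 1 := by
    ext v
    exact LinearMap.congr_fun h₂ v
  have r₃ : e₃ * p₃ * e₃ = (l * l) • 1 := by
    ext v
    exact LinearMap.congr_fun h₃ v
  apply_fun LinearMap.det at r r₁ r₂ r₃
  simp only [map_mul, LinearMap.det_smul, map_one, mul_one, ← hN, d₁, d₂, d₃] at r r₁ r₂ r₃
  refine ⟨m₁ + m₂ + m₃, ?_, ?_, ?_⟩
  · simp only [Multiset.card_add, c₁, c₂, c₃]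
    ring
  · intro b hb
    rw [Multiset.mem_add, Multiset.mem_add] at hb
    exact hb.imp (Or.imp (s₁ b) (s₂ b)) (s₃ b)
  · rw [Multiset.prod_add, Multiset.prod_add, ← r₁, r]
    calc
      l ^ (4 * N) = (l * l) ^ N * (l * l) ^ N := by ring
      _ = (LinearMap.det e₂ * m₂.prod * LinearMap.det e₂) *
          (LinearMap.det e₃ * m₃.prod * LinearMap.det e₃) := by rw [r₂, r₃]
      _ = _ := by ring

/-- If all eigenvalues of `a` are `N`-th roots of unity, then `a ^ N` is unipotent. -/
lemma isNilpotent_pow_sub_one_of_spectrum {K A : Type*} [Field K] [IsAlgClosed K] [Ring A]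
    [Algebra K A] {a : A} (ha : IsIntegral K a) {N : ℕ} (h : ∀ μ ∈ spectrum K a, μ ^ N = 1) :
    IsNilpotent (a ^ N - 1) := by
  have hroot : ∀ μ ∈ (minpoly K a).roots, μ ∈ spectrum K a := by
    intro μ hμ hu
    obtain ⟨q, hq⟩ := Polynomial.dvd_iff_isRoot.2 (Polynomial.isRoot_of_mem_roots hμ)
    have h0 := minpoly.aeval K a
    have hq0 : q ≠ 0 := by
      rintro rfl
      exact minpoly.ne_zero ha (by simpa using hq)
    rw [hq, map_mul] at h0
    have hunit : IsUnit (Polynomial.aeval a (Polynomial.X - Polynomial.C μ)) := by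
      rw [← IsUnit.neg_iff]
      simpa [spectrum.mem_resolventSet_iff] using hu
    rw [hunit.mul_right_eq_zero] at h0
    have hdeg := Polynomial.natDegree_le_natDegree (minpoly.degree_le_of_ne_zero K a hq0 h0)
    rw [hq, Polynomial.natDegree_mul (Polynomial.X_sub_C_ne_zero μ) hq0,
      Polynomial.natDegree_X_sub_C] at hdeg
    omega
  refine ⟨(minpoly K a).roots.card, ?_⟩
  have hd : minpoly K a ∣ (Polynomial.X ^ N - 1) ^ (minpoly K a).roots.card := by
    conv_lhs => rw [(IsAlgClosed.splits (minpoly K a)).eq_prod_roots_of_monic (minpoly.monic ha)]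
    generalize (minpoly K a).roots = s at hroot
    induction s using Multiset.induction with
    | empty => simp
    | cons μ s ih =>
      rw [Multiset.map_cons, Multiset.prod_cons, Multiset.card_cons, pow_succ']
      refine mul_dvd_mul ?_ (ih fun ν hν => hroot ν (Multiset.mem_cons_of_mem hν))
      rw [Polynomial.dvd_iff_isRoot]
      simp [h μ (hroot μ (Multiset.mem_cons_self μ s))]
  obtain ⟨q, hq⟩ := hd
  have := congrArg (Polynomial.aeval a) hq
  simpa using this

end LinearAlgebra

/-! ### Endomorphism algebras in linear categories -/

section Linear
variable {C : Type u} [Category.{v} C] [Preadditive C] [Linear ℂ C]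

/-- Postcomposition with endomorphisms of `X`, as a representation of `End X` on `P ⟶ X`. -/
def postcompAlgHom (P X : C) : End X →ₐ[ℂ] Module.End ℂ (P ⟶ X) where
  toFun f := Linear.rightComp ℂ P f
  map_one' := by ext; simp [End.one_def]
  map_mul' f g := by ext; simp [End.mul_def]
  map_zero' := by ext; simp
  map_add' f g := by ext φ; exact Preadditive.comp_add _ _ _ φ f g
  commutes' r := by
    ext φ
    exact (Linear.comp_smul _ _ _ φ r (𝟙 X)).trans (by simp)

/-- Conjugation by an isomorphism, as an isomorphism of endomorphism algebras. -/
def CategoryTheory.Iso.conjAlgEquiv {X Y : C} (i : X ≅ Y) : End X ≃ₐ[ℂ] End Y :=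
  AlgEquiv.ofLinearEquiv (Linear.homCongr ℂ i i) 
    ((Linear.homCongr_apply ℂ i i (𝟙 X)).trans (by simp [End.one_def])) (fun f g => by
      simp only [End.mul_def]
      exact (Linear.homCongr_apply ℂ i i (g ≫ f)).trans
        (Eq.trans (by simp) (congrArg₂ (· ≫ ·) (Linear.homCongr_apply ℂ i i g)
          (Linear.homCongr_apply ℂ i i f)).symm))

open scoped ModuleCat.Algebra in
/-- A finite category has finite dimensional morphism spaces, and an object `P`, the copy of the
regular representation, that has nonzero morphisms to all nonzero objects. -/
lemma IsFiniteLinearCategory.exists_generator (hC : IsFiniteLinearCategory C) :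
    (∀ X Y : C, Module.Finite ℂ (X ⟶ Y)) ∧
      ∃ P : C, ∀ X : C, ¬ Limits.IsZero X → ∃ φ : P ⟶ X, φ ≠ 0 := by
  obtain ⟨A, _, _, _, e, _, _⟩ := hC
  refine ⟨fun X Y => ?_, ?_⟩
  · have : Module.Finite ℂ (e.functor.obj X).obj := (e.functor.obj X).property
    have : Module.Finite ℂ (e.functor.obj Y).obj := (e.functor.obj Y).property
    let L : (X ⟶ Y) →ₗ[ℂ] (e.functor.obj X).obj →ₗ[ℂ] (e.functor.obj Y).obj :=
      { toFun := fun f => (e.functor.map f).hom.hom.restrictScalars ℂ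
        map_add' := fun f g => by
          rw [e.functor.map_add]
          rfl
        map_smul' := fun r f => by
          rw [e.functor.map_smul]
          rfl }
    refine Module.Finite.of_injective L fun f g h => e.functor.map_injective ?_
    ext x
    exact LinearMap.congr_fun h x
  · have hA : IsFinDimRep A (ModuleCat.of A A) := by
      have h : (ModuleCat.moduleOfAlgebraModule (ModuleCat.of A A) : Module ℂ A) =
          Algebra.toModule :=
        Module.ext' _ _ fun r x => (Algebra.smul_def r x).symm
      change @Module.Finite ℂ A _ _ (ModuleCat.moduleOfAlgebraModule (ModuleCat.of A A))
      rwa [h]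
    let R : FinDimRep A := ⟨ModuleCat.of A A, hA⟩
    refine ⟨e.inverse.obj R, fun X hX => ?_⟩
    obtain ⟨m, hm⟩ : ∃ m : (e.functor.obj X).obj, m ≠ 0 := by
      by_contra! h
      apply hX
      rw [Limits.IsZero.iff_id_eq_zero]
      apply e.functor.map_injective
      ext x
      rw [h x, map_zero, map_zero]
    let ψ : R ⟶ e.functor.obj X :=
      ObjectProperty.homMk (ModuleCat.ofHom (LinearMap.toSpanSingleton A _ m))
    refine ⟨e.functor.preimage ((e.counitIso.app R).hom ≫ ψ), fun h => hm ?_⟩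
    have h0 := congrArg e.functor.map h
    rw [e.functor.map_preimage, e.functor.map_zero, Preadditive.IsIso.comp_left_eq_zero] at h0
    have h1 := congrArg (fun f : R ⟶ e.functor.obj X => f.hom.hom (1 : A)) h0
    exact (one_smul A m).symm.trans h1

variable [MonoidalCategory C] [MonoidalPreadditive C] [MonoidalLinear ℂ C]

/-- `f ↦ X ◁ f` as a homomorphism of endomorphism algebras. -/
def whiskerLeftAlgHom (X Y : C) : End Y →ₐ[ℂ] End (X ⊗ Y) where
  toFun f := X ◁ f
  map_one' := by simp [End.one_def]
  map_mul' f g := by simp [End.mul_def]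
  map_zero' := by simp
  map_add' f g := MonoidalPreadditive.whiskerLeft_add f g
  commutes' r := (MonoidalLinear.whiskerLeft_smul X r (𝟙 Y)).trans (by rw [whiskerLeft_id]; rfl)

/-- `f ↦ f ▷ Y` as a homomorphism of endomorphism algebras. -/
def whiskerRightAlgHom (X Y : C) : End X →ₐ[ℂ] End (X ⊗ Y) where
  toFun f := f ▷ Y
  map_one' := by simp [End.one_def]
  map_mul' f g := by simp [End.mul_def]
  map_zero' := by simp
  map_add' f g := MonoidalPreadditive.add_whiskerRight f g
  commutes' r := (MonoidalLinear.smul_whiskerRight r (𝟙 X) Y).trans (by rw [id_whiskerRight]; rfl)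

end Linear

/-! ### Eigenvalues of the Casimir morphisms -/

section Braided

variable {C : Type u} [Category.{v} C] [Abelian C] [Linear ℂ C]
    [MonoidalCategory C] [MonoidalPreadditive C] [MonoidalLinear ℂ C]
    [BraidedCategory C] [RigidCategory C]

/-- The set of all eigenvalues of the Casimir morphisms of the objects of `C`. -/
def casimirSpectrum (C : Type u) [Category.{v} C] [Abelian C] [Linear ℂ C]
    [MonoidalCategory C] [MonoidalPreadditive C] [MonoidalLinear ℂ C]
    [BraidedCategory C] [RigidCategory C] : Set ℂ :=
  {l | ∃ X : C, l ∈ spectrum ℂ (casimir X)}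

/-- By naturality, `z` is the scalar `l` on the kernel and on the cokernel of `z_X - l`. -/
lemma exists_casimir_eq_smul {l : ℂ} (hl : l ∈ casimirSpectrum C) :
    ∃ X : C, ¬ Limits.IsZero X ∧ casimir X = l • 𝟙 X := by
  obtain ⟨X, hX⟩ := hl
  have hc := isCasimir_casimir X
  obtain ⟨c, h⟩ : ∃ c : X ⟶ X, casimir X = c := ⟨_, rfl⟩
  rw [h] at hX hc
  set g : X ⟶ X := c - l • 𝟙 X with hg
  have hiso : ¬ IsIso g := by
    intro hi
    apply hX
    rw [spectrum.mem_resolventSet_iff, ← IsUnit.neg_iff, isUnit_iff_isIso]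
    change IsIso (-(l • 𝟙 X - c))
    rwa [neg_sub]
  by_cases hm : Mono g
  · have he : ¬ Epi g := fun he => hiso (isIso_of_mono_of_epi g)
    refine ⟨Limits.cokernel g, fun h0 => he ?_, ?_⟩
    · exact Preadditive.epi_of_isZero_cokernel g h0
    · rw [← cancel_epi (Limits.cokernel.π g),
        ← hc.naturality (isCasimir_casimir _) (Limits.cokernel.π g)]
      have := Limits.cokernel.condition g
      simpa [hg, sub_eq_zero] using this
  · refine ⟨Limits.kernel g, fun h0 => hm ?_, ?_⟩
    · exact Preadditive.mono_of_isZero_kernel g h0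
    · rw [← cancel_mono (Limits.kernel.ι g),
        (isCasimir_casimir _).naturality hc (Limits.kernel.ι g)]
      have := Limits.kernel.condition g
      simpa [hg, sub_eq_zero] using this

/-- Every eigenvalue of a Casimir morphism is already one on a generator. -/
lemma casimirSpectrum_subset {P : C} (hP : ∀ X : C, ¬ Limits.IsZero X → ∃ φ : P ⟶ X, φ ≠ 0) :
    casimirSpectrum C ⊆ spectrum ℂ (postcompAlgHom P P (casimir P)) := by
  intro l hl
  obtain ⟨X, hX, hz⟩ := exists_casimir_eq_smul hl
  obtain ⟨φ, hφ⟩ := hP X hX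
  intro hu
  rw [spectrum.mem_resolventSet_iff, Module.End.isUnit_iff] at hu
  obtain ⟨ψ, hψ⟩ := hu.2 (𝟙 P)
  change l • ψ - ψ ≫ casimir P = 𝟙 P at hψ
  apply hφ
  rw [← Category.id_comp φ, ← hψ, Preadditive.sub_comp, Category.assoc,
    (isCasimir_casimir P).naturality (isCasimir_casimir X) φ, hz]
  simp

lemma ne_zero_of_mem_casimirSpectrum {l : ℂ} (hl : l ∈ casimirSpectrum C) : l ≠ 0 := by
  rintro rfl
  obtain ⟨X, hX, hz⟩ := exists_casimir_eq_smul hl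
  apply hX
  rw [Limits.IsZero.iff_id_eq_zero]
  apply eq_of_whiskerRight_comp_evaluation (Y := leftDual X)
  have h := isCasimir_casimir X _ (ε_ (leftDual X) X)
  have : IsIso (doubleBraiding X (leftDual X)) := by
    rw [doubleBraiding]; infer_instance
  rw [hz] at h
  simp only [zero_smul, MonoidalPreadditive.zero_whiskerRight, Limits.zero_comp,
    Preadditive.IsIso.comp_left_eq_zero] at h
  simp [h]

end Braided

/-! ### Quasi-unipotent endomorphisms -/

section Quasi

variable {C : Type u} [Category.{v} C] [Preadditive C]

lemma IsQuasiUnipotent.map {X Y : C} {f : End X} (hf : IsQuasiUnipotent f)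
    (Φ : End X →+* End Y) : IsQuasiUnipotent (Φ f) := by
  obtain ⟨N, hN, h⟩ := hf
  exact ⟨N, hN, by simpa only [map_sub, map_pow, map_one] using h.map Φ⟩

lemma IsQuasiUnipotent.mul {X : C} {f g : End X} (hf : IsQuasiUnipotent f)
    (hg : IsQuasiUnipotent g) (hfg : Commute f g) : IsQuasiUnipotent (f * g) := by
  obtain ⟨N, hN, h⟩ := hf
  obtain ⟨M, hM, h'⟩ := hg
  have key : ∀ {a : End X} {k : ℕ}, IsNilpotent (a - 1) → IsNilpotent (a ^ k - 1) := by
    intro a k ha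
    rw [← mul_geom_sum]
    exact (Commute.sum_right _ _ _ fun i _ =>
      ((Commute.refl a).pow_right i).sub_left (Commute.one_left _)).isNilpotent_mul_right ha
  refine ⟨N * M, Nat.mul_pos hN hM, ?_⟩
  have hf' : IsNilpotent (f ^ (N * M) - 1) := by rw [pow_mul]; exact key h
  have hg' : IsNilpotent (g ^ (N * M) - 1) := by rw [mul_comm, pow_mul]; exact key h'
  have e : (f * g) ^ (N * M) - 1 =
      (f ^ (N * M) - 1) * g ^ (N * M) + (g ^ (N * M) - 1) := by
    rw [hfg.mul_pow]
    noncomm_ring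
  have c : Commute (f ^ (N * M) - 1) (g ^ (N * M)) :=
    (hfg.pow_pow _ _).sub_left (Commute.one_left _)
  rw [e]
  exact ((c.mul_left (Commute.refl _)).sub_right (Commute.one_right _)).isNilpotent_add
    (c.isNilpotent_mul_right hf') hg'

lemma IsQuasiUnipotent.isUnit {X : C} {f : End X} (hf : IsQuasiUnipotent f) : IsUnit f := by
  obtain ⟨N, hN, h⟩ := hf
  rw [← isUnit_pow_iff hN.ne']
  simpa using h.isUnit_add_one

lemma IsQuasiUnipotent.units_inv {X : C} {f : (End X)ˣ}
    (hf : IsQuasiUnipotent (f : End X)) : IsQuasiUnipotent (↑f⁻¹ : End X) := by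
  obtain ⟨N, hN, h⟩ := hf
  refine ⟨N, hN, ?_⟩
  have c : Commute ((f : End X) ^ N - 1) ((↑f⁻¹ : End X) ^ N) :=
    (((Commute.refl (f : End X)).units_inv_right).pow_pow N N).sub_left (Commute.one_left _)
  have e : (↑f⁻¹ : End X) ^ N - 1 = -(((f : End X) ^ N - 1) * (↑f⁻¹ : End X) ^ N) := by
    rw [sub_mul, one_mul, ← Units.val_pow_eq_pow_val, ← Units.val_pow_eq_pow_val,
      ← Units.val_mul, inv_pow, mul_inv_cancel, Units.val_one, neg_sub]
  rw [e]
  exact (c.isNilpotent_mul_right h).neg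

lemma IsQuasiUnipotent.of_mul_self {X : C} {f : End X} (hf : IsQuasiUnipotent (f * f)) :
    IsQuasiUnipotent f := by
  obtain ⟨N, hN, h⟩ := hf
  refine ⟨2 * N, by omega, ?_⟩
  rwa [pow_mul, sq]

end Quasi

/-! ### Eigenvalues of the Casimir morphisms are roots of unity -/

section Braided

variable {C : Type u} [Category.{v} C] [Abelian C] [Linear ℂ C]
    [MonoidalCategory C] [MonoidalPreadditive C] [MonoidalLinear ℂ C]
    [BraidedCategory C] [RigidCategory C]

lemma braidingSq_mul_casimir_mul_braidingSq (X Z : C) :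
    braidingSq X Z * casimir (X ⊗ Z) * braidingSq X Z =
      whiskerRightAlgHom X Z (casimir X) * whiskerLeftAlgHom X Z (casimir Z) :=
  (isCasimir_casimir X).tensor (isCasimir_casimir Z) (isCasimir_casimir (X ⊗ Z))

lemma braidingSq_mul_casimir_mul_braidingSq_of_smul {X Z : C} {x z : ℂ} (hx : casimir X = x • 𝟙 X)
    (hz : casimir Z = z • 𝟙 Z) :
    braidingSq X Z * casimir (X ⊗ Z) * braidingSq X Z = (x * z) • 1 := by
  have hx' : casimir X = algebraMap ℂ (End X) x := hx
  have hz' : casimir Z = algebraMap ℂ (End Z) z := hz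
  rw [braidingSq_mul_casimir_mul_braidingSq, hx', hz', AlgHom.commutes, AlgHom.commutes, ← map_mul,
    Algebra.algebraMap_eq_smul_one]

/-- The determinant of the hexagon identity for `X`, `*X`, `X` on an eigenspace of the Casimir
morphism, where `X` is a nonzero object with `z_X = l`. -/
lemma exists_multiset_of_mem_casimirSpectrum (hfin : ∀ X Y : C, Module.Finite ℂ (X ⟶ Y))
    {P : C} (hP : ∀ X : C, ¬ Limits.IsZero X → ∃ φ : P ⟶ X, φ ≠ 0) {l : ℂ}
    (hl : l ∈ casimirSpectrum C) :
    ∃ N > 0, ∃ m : Multiset ℂ, m.card = 3 * N ∧ (∀ b ∈ m, b ∈ casimirSpectrum C) ∧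
      l ^ (4 * N) = m.prod := by
  obtain ⟨X, hX, hz⟩ := exists_casimir_eq_smul hl
  set Y := leftDual X with hY
  have hzY : casimir Y = l • 𝟙 Y := by
    refine IsCasimir.eq_casimir (IsCasimir.smul_leftDual ?_)
    rw [← hz]
    exact isCasimir_casimir X
  -- `Φ₁`, `Φ₂`, `Φ₃` let endomorphisms of `Y ⊗ X`, `X ⊗ Y`, `X ⊗ X` act on two of the three factors
  -- of `X ⊗ Y ⊗ X`; for the outer two factors, the first is carried past `Y` by the braiding.
  let c : X ⊗ Y ⊗ X ≅ Y ⊗ X ⊗ X :=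
    (α_ X Y X).symm ≪≫ whiskerRightIso (β_ X Y) X ≪≫ α_ Y X X
  let Φ₁ : End (Y ⊗ X) →ₐ[ℂ] End (X ⊗ Y ⊗ X) := whiskerLeftAlgHom X (Y ⊗ X)
  let Φ₂ : End (X ⊗ Y) →ₐ[ℂ] End (X ⊗ Y ⊗ X) :=
    (α_ X Y X).conjAlgEquiv.toAlgHom.comp (whiskerRightAlgHom (X ⊗ Y) X)
  let Φ₃ : End (X ⊗ X) →ₐ[ℂ] End (X ⊗ Y ⊗ X) :=
    c.symm.conjAlgEquiv.toAlgHom.comp (whiskerLeftAlgHom Y (X ⊗ X))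
  let Ψ := postcompAlgHom P (X ⊗ Y ⊗ X)
  have hE : braidingSq X (Y ⊗ X) = Φ₂ (braidingSq X Y) * Φ₃ (braidingSq X X) := by
    change doubleBraiding X (Y ⊗ X) =
      ((c.symm.inv ≫ Y ◁ doubleBraiding X X) ≫ c.symm.hom) ≫
        ((α_ X Y X).inv ≫ doubleBraiding X Y ▷ X) ≫ (α_ X Y X).hom
    rw [doubleBraiding_tensor_right]
    simp [c, doubleBraiding]
  have h₁ : braidingSq X (Y ⊗ X) * casimir (X ⊗ Y ⊗ X) * braidingSq X (Y ⊗ X) =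
      l • Φ₁ (casimir (Y ⊗ X)) := by
    have hz' : casimir X = algebraMap ℂ (End X) l := hz
    rw [braidingSq_mul_casimir_mul_braidingSq, hz', AlgHom.commutes, ← Algebra.smul_def]
  have hcomm : ∀ f : End (X ⊗ Y ⊗ X), Commute (Ψ (casimir (X ⊗ Y ⊗ X))) (Ψ f) :=
    fun f => (commute_casimir f).map Ψ
  obtain ⟨m, hm, hspec, hprod⟩ := Module.End.exists_multiset_of_hexagon
    (ne_zero_of_mem_casimirSpectrum hl) (hcomm (braidingSq X (Y ⊗ X)))
    (hcomm (Φ₂ (braidingSq X Y))) (hcomm (Φ₃ (braidingSq X X)))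
    (hcomm (Φ₁ (casimir (Y ⊗ X)))) (hcomm (Φ₂ (casimir (X ⊗ Y)))) (hcomm (Φ₃ (casimir (X ⊗ X))))
    (by rw [hE, map_mul]) (by rw [← map_mul, ← map_mul, h₁, map_smul])
    (by
      rw [← map_mul, ← map_mul, ← map_mul, ← map_mul,
        braidingSq_mul_casimir_mul_braidingSq_of_smul hz hzY, map_smul, map_smul, map_one, map_one])
    (by
      rw [← map_mul, ← map_mul, ← map_mul, ← map_mul,
        braidingSq_mul_casimir_mul_braidingSq_of_smul hz hz, map_smul, map_smul, map_one, map_one])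
  refine ⟨_, ?_, m, hm, ?_, hprod⟩
  · obtain ⟨φ, hφ⟩ := hP X hX
    -- the zigzag identity makes `X` a retract of `X ⊗ Y ⊗ X`
    let s : X ⟶ X ⊗ Y ⊗ X := (ρ_ X).inv ≫ X ◁ η_ Y X
    have hs : s ≫ (α_ X Y X).inv ≫ ε_ Y X ▷ X ≫ (λ_ X).hom = 𝟙 X := by
      have := ExactPairing.coevaluation_evaluation_assoc Y X (λ_ X).hom
      simp only [s, Category.assoc, this]
      simp
    have : Nontrivial ((Ψ (casimir (X ⊗ Y ⊗ X))).eigenspace l) := by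
      refine ⟨⟨⟨φ ≫ s, ?_⟩, 0, fun h => hφ ?_⟩⟩
      · rw [Module.End.mem_eigenspace_iff]
        have h := (isCasimir_casimir X).naturality (isCasimir_casimir _) s
        change (φ ≫ s) ≫ casimir (X ⊗ Y ⊗ X) = l • (φ ≫ s)
        rw [Category.assoc, ← h, hz]
        simp
      · have h' : φ ≫ s = 0 := congrArg Subtype.val h
        rw [← Category.comp_id φ, ← hs, reassoc_of% h']
        simp
    exact Module.finrank_pos
  · rintro b hb
    rcases hspec b hb with (h | h) | h
    · exact ⟨_, AlgHom.spectrum_apply_subset (Ψ.comp Φ₁) _ h⟩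
    · exact ⟨_, AlgHom.spectrum_apply_subset (Ψ.comp Φ₂) _ h⟩
    · exact ⟨_, AlgHom.spectrum_apply_subset (Ψ.comp Φ₃) _ h⟩

lemma IsFiniteLinearCategory.exists_pow_eq_one (hC : IsFiniteLinearCategory C) :
    ∃ N > 0, ∀ l ∈ casimirSpectrum C, l ^ N = 1 := by
  obtain ⟨hfin, P, hP⟩ := hC.exists_generator
  have hS : (casimirSpectrum C).Finite :=
    (Module.End.finite_spectrum (postcompAlgHom P P (casimir P))).subset
      (casimirSpectrum_subset hP)
  have hU := hS.preimage (f := Units.val) Units.val_injective.injOn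
  have hord : ∀ l ∈ casimirSpectrum C, IsOfFinOrder l := by
    intro l hl
    lift l to ℂˣ using (ne_zero_of_mem_casimirSpectrum hl).isUnit
    rw [Units.isOfFinOrder_val]
    refine Finset.isOfFinOrder_of_pow_eq_multiset_prod hU.toFinset (fun a ha => ?_) l
      (by simpa using hl)
    obtain ⟨N, hN, m, hm, hmem, hprod⟩ := exists_multiset_of_mem_casimirSpectrum hfin hP
      (l := (a : ℂ)) (by simpa using ha)
    lift m to Multiset ℂˣ using fun b hb => (ne_zero_of_mem_casimirSpectrum (hmem b hb)).isUnit
    refine ⟨N, hN, m, by simpa using hm, fun b hb => ?_, ?_⟩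
    · simpa using hmem b (Multiset.mem_map_of_mem _ hb)
    · apply Units.ext
      exact hprod.trans (map_multiset_prod (Units.coeHom ℂ) m).symm
  refine ⟨∏ l ∈ hS.toFinset, orderOf l, Finset.prod_pos fun l hl => ?_, fun l hl => ?_⟩
  · exact (hord l (by simpa using hl)).orderOf_pos
  · exact orderOf_dvd_iff_pow_eq_one.1 (Finset.dvd_prod_of_mem _ (by simpa using hl))

end Braided

theorem mainTheorem1 (C : Type u) [Category.{v} C] [Abelian C] [Linear ℂ C]
    [MonoidalCategory C] [MonoidalPreadditive C] [MonoidalLinear ℂ C]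
    [BraidedCategory C] [RigidCategory C]
    (hC : IsFiniteLinearCategory C) :
    (∀ X Y : C, IsQuasiUnipotent (braidingSq X Y)) ∧
      ∀ X : C, IsQuasiUnipotent (casimir X) := by
  have hcas : ∀ X : C, IsQuasiUnipotent (casimir X) := fun X => by
    obtain ⟨N, hN, h⟩ := hC.exists_pow_eq_one
    have : Module.Finite ℂ (End X) := hC.exists_generator.1 X X
    exact ⟨N, hN, isNilpotent_pow_sub_one_of_spectrum (Algebra.IsIntegral.isIntegral (casimir X))
      fun μ hμ => h μ ⟨X, hμ⟩⟩
  refine ⟨fun X Y => ?_, hcas⟩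
  -- The square of `braidingSq X Y` is the quasi-unipotent `z_X ⊗ z_Y` divided by `z_{X ⊗ Y}`.
  have h := braidingSq_mul_casimir_mul_braidingSq X Y
  have hw := ((hcas X).map (whiskerRightAlgHom (C := C) X Y).toRingHom).mul
    ((hcas Y).map (whiskerLeftAlgHom (C := C) X Y).toRingHom) (whisker_exchange _ _)
  change IsQuasiUnipotent (whiskerRightAlgHom X Y (casimir X) * whiskerLeftAlgHom X Y (casimir Y))
    at hw
  have hz := hcas (X ⊗ Y)
  have hcomm := commute_casimir (X := X ⊗ Y)
  obtain ⟨t, ht⟩ := hz.isUnit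
  rw [← ht] at h hz hcomm
  rw [← h, mul_assoc, (hcomm _).eq, ← mul_assoc] at hw
  have := hw.mul hz.units_inv ((hcomm _).symm.units_inv_right)
  rw [Units.mul_inv_cancel_right] at this
  exact this.of_mul_self
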